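/- Conventions. For a submonoid $M\subset\mathbb Z^d$ let $U(M)=M\cap(-M)$. A set $H$ is a system of generators of $M$ modulo $U(M)$ if $M=\mathbb Z_+H+U(M)$; it is a Hilbert basis of $M$ if it is minimal (under inclusion) with this property. An element $y\in M$ reduces $x\in M$ in $M$ if $y\notin U(M)$, $x\ne y$ and $x-y\in M$. An auto-reduction of $E\subset M$ in $M$ is a subset $E'\subset E$ such that $E'\cap U(M)=\emptyset$, no element of $E'$ is reduced by another one, and every $x\in E\setminus E'$ is in $U(M)$ or is reduced by some element of $E'$. Let $C\subset\mathbb R^d$ be a rational cone (the intersection of finitely many linear halfspaces given by linear forms with rational coefficients; not necessarily pointed or full-dimensional), $M=C\cap\mathbb Z^d$, $B$ a Hilbert basis of $M$, and $\lambda$ an integral linear form on $\mathbb Z^d$. Put $M^+=\{x\in M:\lambda(x)\ge 0\}$ and $M^-=\{x\in M:\lambda(x)\le 0\}$. Sets $B_i^+,B_i^-$ and $B_i=B_i^+\cup B_i^-$ $(i\ge 0)$ are constructed as follows. (1) If $\lambda$ vanishes on $U(M)$, let $B_0=B$. Otherwise choose a $\mathbb Z$-basis of $U(M^+)$ and an element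 $h\in U(M)$ with $\lambda(h)\ge 0$ that supplements it to a $\mathbb Z$-basis of $U(M)$ (so that $\lambda(h)>0$), and let $B_0$ consist of $h$, $-h$, the elements $x-\lfloor\lambda(x)/\lambda(h)\rfloor h$ for $x\in B$ with $\lambda(x)\ge 0$, and the elements $x+\lfloor-\lambda(x)/\lambda(h)\rfloor h$ for $x\in B$ with $\lambda(x)\le 0$. In both cases $B_0^+=\{x\in B_0:\lambda(x)\ge 0\}$ and $B_0^-=\{x\in B_0:\lambda(x)\le 0\}$. (2) For $i\ge 1$ let $\tilde B_i=B_{i-1}\cup\{x+y: x,y\in B_{i-1},\ \lambda(x)>0,\ \lambda(y)<0,\ x+y\ne 0\}$; let $B_i^+$ be an auto-reduction of $\{x\in\tilde B_i:\lambda(x)\ge 0\}$ in $M^+$ and $B_i^-$ an auto-reduction of $\{x\in\tilde B_i:\lambda(x)\le 0\}$ in $M^-$. Then, for every choice of $h$ and of the auto-reductions: (i) Suppose that new sums are tested against the old elements, that is, for all $i\ge1$ no element of $B_i^+\setminus B_{i-1}$ is reduced in $M^+$ by an element of $B_{i-1}^+$, and no element of $B_i^-\setminus B_{i-1}$ is reduced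 in $M^-$ by an element of $B_{i-1}^-$. Then there exists an $i\ge 1$ with $B_i=B_{i-1}$. (ii) Whenever $B_i=B_{i-1}$ for some $i\ge 1$, the set $B_i^+$ is a Hilbert basis of $M^+$ and $B_i^-$ is a Hilbert basis of $M^-$. -/

import Mathlib

namespace HalfspaceCut

/-- A rational cone in `ℝ^d`: the intersection of finitely many halfspaces given by linear forms
with rational coefficients. -/
def IsRationalCone {d : ℕ} (C : PointedCone ℝ (Fin d → ℝ)) : Prop :=
  ∃ S : Finset (Fin d → ℚ), ∀ x : Fin d → ℝ, x ∈ C ↔ ∀ a ∈ S, 0 ≤ ∑ i, (a i : ℝ) * x i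

/-- The monoid `C ∩ ℤ^d`. -/
def latticePoints {d : ℕ} (C : PointedCone ℝ (Fin d → ℝ)) : AddSubmonoid (Fin d → ℤ) :=
  C.toAddSubmonoid.comap ((Int.castAddHom ℝ).compLeft (Fin d))

section Monoids

variable {G : Type*} [AddCommGroup G]

/-- The unit group `U(M) = M ∩ -M` of a submonoid `M` of an abelian group. -/
abbrev units (M : AddSubmonoid G) : AddSubgroup G := M.support

/-- `H` is a system of generators of `M` modulo `U(M)`: `M = ℤ₊ H + U(M)`. -/
def GeneratesModUnits (M : AddSubmonoid G) (H : Set G) : Prop :=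
  AddSubmonoid.closure H ⊔ (units M).toAddSubmonoid = M

/-- A Hilbert basis of `M`: a system of generators modulo `U(M)` that is minimal with respect to
inclusion. -/
def IsHilbertBasis (M : AddSubmonoid G) (H : Set G) : Prop :=
  Minimal (GeneratesModUnits M) H

/-- `y` reduces `x` in `M`. -/
def Reduces (M : AddSubmonoid G) (y x : G) : Prop :=
  y ∉ units M ∧ x ≠ y ∧ x - y ∈ M

/-- `E'` is an auto-reduction of `E` in `M`: a possible outcome of removing all units from `E` and
then discarding elements that are reduced by another remaining element until no element is reduced
by another one. Thus `E' ⊆ E` contains no units, no element of `E'` is reduced by another one, and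
every discarded element is a unit or is reduced by an element that has been kept. -/
structure IsAutoReduction (M : AddSubmonoid G) (E E' : Set G) : Prop where
  subset : E' ⊆ E
  not_unit : ∀ x ∈ E', x ∉ units M
  not_reduced : ∀ x ∈ E', ∀ y ∈ E', ¬ Reduces M y x
  discarded : ∀ x ∈ E, x ∉ E' → x ∈ units M ∨ ∃ y ∈ E', Reduces M y x

/-- The family `b` is a `ℤ`-basis of the subgroup `U`. -/
def IsZBasis (U : AddSubgroup G) {n : ℕ} (b : Fin n → G) : Prop :=
  LinearIndependent ℤ b ∧ AddSubgroup.closure (Set.range b) = U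

/-- `M⁺ = M ∩ {lam ≥ 0}`. -/
def cutPos (M : AddSubmonoid G) (lam : G →ₗ[ℤ] ℤ) : AddSubmonoid G where
  carrier := {x | x ∈ M ∧ 0 ≤ lam x}
  zero_mem' := ⟨M.zero_mem, by simp⟩
  add_mem' := fun hx hy => ⟨M.add_mem hx.1 hy.1, by
    rw [map_add]; exact add_nonneg hx.2 hy.2⟩

/-- `M⁻ = M ∩ {lam ≤ 0}`. -/
def cutNeg (M : AddSubmonoid G) (lam : G →ₗ[ℤ] ℤ) : AddSubmonoid G where
  carrier := {x | x ∈ M ∧ lam x ≤ 0}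
  zero_mem' := ⟨M.zero_mem, by simp⟩
  add_mem' := fun hx hy => ⟨M.add_mem hx.1 hy.1, by
    rw [map_add]; exact add_nonpos hx.2 hy.2⟩

/-- The element that replaces `x` in the set `B₀` in the case where `lam` does not vanish on the
units: `x - a h` with `a = ⌊lam x / lam h⌋` if `lam x ≥ 0`, and `x - a (-h)` with
`a = ⌊lam (-x) / lam h⌋` if `lam x ≤ 0`
(for `lam x = 0` both are `x`). The division of integers rounds down, as `lam h > 0`. -/
def shift (lam : G →ₗ[ℤ] ℤ) (h x : G) : G :=
  if 0 ≤ lam x then x - (lam x / lam h) • h else x - (lam (-x) / lam h) • (-h)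

/-- `B₀` is a possible initial set, computed from the Hilbert basis `B` of `M`: either `lam`
vanishes on `U(M)` and `B₀ = B`, or it does not, some basis of `U(M⁺)` is supplemented to a basis
of `U(M)` by an element `h` of `U(M)⁺`, and `B₀` consists of the shifted elements of `B` together
with `h` and `-h`. -/
def IsInitialSet (M : AddSubmonoid G) (lam : G →ₗ[ℤ] ℤ) (B B₀ : Set G) : Prop :=
  ((∀ u ∈ units M, lam u = 0) ∧ B₀ = B) ∨
  ((∃ u ∈ units M, lam u ≠ 0) ∧
    ∃ (n : ℕ) (b : Fin n → G) (h : G),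
      IsZBasis (units (cutPos M lam)) b ∧
      h ∈ units M ∧ 0 ≤ lam h ∧
      IsZBasis (units M) (Fin.cons h b : Fin (n + 1) → G) ∧
      B₀ = shift lam h '' B ∪ {h, -h})

/-- `B` together with all nonzero sums `x + y`, where `x, y ∈ B`, `lam x > 0` and `lam y < 0`. -/
def extend (lam : G →ₗ[ℤ] ℤ) (B : Set G) : Set G :=
  B ∪ {z | ∃ x ∈ B, ∃ y ∈ B, 0 < lam x ∧ lam y < 0 ∧ x + y ≠ 0 ∧ z = x + y}

/-- `Bp i = B_i⁺` and `Bm i = B_i⁻` are the sets produced by a run of the halfspace cutting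
algorithm that starts from the Hilbert basis `B` of `M`; the set `B_i` is `Bp i ∪ Bm i`. No
assumption is made on the choices left open by the algorithm (the element `h` and the
auto-reductions). -/
structure IsRun (M : AddSubmonoid G) (lam : G →ₗ[ℤ] ℤ) (B : Set G) (Bp Bm : ℕ → Set G) :
    Prop where
  init : ∃ B₀ : Set G, IsInitialSet M lam B B₀ ∧
    Bp 0 = {x ∈ B₀ | 0 ≤ lam x} ∧ Bm 0 = {x ∈ B₀ | lam x ≤ 0}
  step_pos : ∀ i, IsAutoReduction (cutPos M lam)
    {x ∈ extend lam (Bp i ∪ Bm i) | 0 ≤ lam x} (Bp (i + 1))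
  step_neg : ∀ i, IsAutoReduction (cutNeg M lam)
    {x ∈ extend lam (Bp i ∪ Bm i) | lam x ≤ 0} (Bm (i + 1))

/-- Newly formed sums are tested against the previous sets: a new element that is
reduced by an element of `B_{i-1}⁺` (respectively `B_{i-1}⁻`) does not enter `B_i⁺`
(respectively `B_i⁻`). -/
def TestsNewAgainstOld (M : AddSubmonoid G) (lam : G →ₗ[ℤ] ℤ) (Bp Bm : ℕ → Set G) : Prop :=
  ∀ i,
    (∀ z ∈ Bp (i + 1), z ∉ Bp i ∪ Bm i → ∀ x ∈ Bp i, ¬ Reduces (cutPos M lam) x z) ∧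
    (∀ z ∈ Bm (i + 1), z ∉ Bp i ∪ Bm i → ∀ x ∈ Bm i, ¬ Reduces (cutNeg M lam) x z)

end Monoids

end HalfspaceCut

/-!
Order a submonoid `M` by divisibility: `x` divides `y` if `y - x ∈ M`. If `M` has a finite Hilbert
basis, this is a well-quasi-order by Dickson's lemma, and so is divisibility in `M⁺` and in `M⁻`.

Termination: if infinitely many steps produced new elements of `M⁺`, one of them would be divisible
in `M⁺` by an earlier one, hence by an element of the current set, against which it was tested. From
some step on the finite sets `B_i` can therefore only shrink.

Correctness: since the initial set generates `M` and survives up to units, every `z ∈ M⁺` is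
`p + m` with `p` generated by `B_i⁺` and `m` by `B_i⁻` (modulo units). If `lam m < 0`, split off
`x ∈ B_i⁺` with `lam x > 0` and `y ∈ B_i⁻` with `lam y < 0`. The sum `x + y` was already considered
by the algorithm, so it lies in one of the two generated submonoids, by well-founded induction on
divisibility; moving it there decreases `lam p`. Once `lam m = 0`, the summands of `m` lie in `M⁺`.
The induction needs that `x + y` is not reduced by a unit of `M`. This is where the elements `±h` of
`B₀` enter: because of them no value of `lam` on `B_i⁺` exceeds a positive value of `lam` on `U(M)`.
-/

namespace HalfspaceCut

section Divisibility

variable {G : Type*} [AddCommGroup G] {M : AddSubmonoid G}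

/-- Divisibility in `M`, in additive notation: `y` is the sum of `x` and an element of `M`. -/
def Divides (M : AddSubmonoid G) (x y : G) : Prop :=
  y - x ∈ M

theorem Divides.refl (M : AddSubmonoid G) (x : G) : Divides M x x := by
  simp [Divides]

theorem Divides.trans {x y z : G} (hxy : Divides M x y) (hyz : Divides M y z) : Divides M x z := by
  simpa [Divides] using add_mem hyz hxy

instance : IsPreorder G (Divides M) where
  refl := Divides.refl M
  trans _ _ _ := Divides.trans

theorem mem_units_of_add_mem_units {a b : G} (ha : a ∈ M) (hb : b ∈ M) (hab : a + b ∈ units M) :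
    a ∈ units M :=
  ⟨ha, by simpa using add_mem hb hab.2⟩

/-- `x` is irreducible in `M`: it is not a unit, and not the sum of two elements of `M` that are
not units. -/
structure IsIrred (M : AddSubmonoid G) (x : G) : Prop where
  not_unit : x ∉ units M
  unit_or_unit : ∀ a ∈ M, ∀ b ∈ M, a + b = x → a ∈ units M ∨ b ∈ units M

theorem IsIrred.add_unit {x u : G} (hx : IsIrred M x) (hu : u ∈ units M) : IsIrred M (x + u) where
  not_unit h := hx.not_unit (by simpa using sub_mem h hu)
  unit_or_unit a ha b hb hab := by
    have hsum : a + (b - u) = x := by rw [← add_sub_assoc, hab, add_sub_cancel_right]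
    refine (hx.unit_or_unit a ha (b - u) ?_ hsum).imp_right fun h => by simpa using add_mem h hu
    rw [sub_eq_add_neg]
    exact add_mem hb hu.2

end Divisibility

section Generation

variable {G : Type*} [AddCommGroup G] {M : AddSubmonoid G} {H : Set G} {x : G}

/-- The submonoid `ℤ₊ H + U(M)`; the set `H` need not be contained in `M`. -/
def genModUnits (M : AddSubmonoid G) (H : Set G) : AddSubmonoid G :=
  AddSubmonoid.closure H ⊔ (units M).toAddSubmonoid

theorem genModUnits_eq_closure (M : AddSubmonoid G) (H : Set G) :
    genModUnits M H = AddSubmonoid.closure (H ∪ units M) := by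
  rw [AddSubmonoid.closure_union, ← AddSubgroup.coe_toAddSubmonoid, AddSubmonoid.closure_eq]
  rfl

theorem mem_genModUnits_of_mem (hx : x ∈ H) : x ∈ genModUnits M H :=
  AddSubmonoid.mem_sup_left (AddSubmonoid.subset_closure hx)

theorem mem_genModUnits_of_unit (hx : x ∈ units M) : x ∈ genModUnits M H :=
  AddSubmonoid.mem_sup_right hx

theorem genModUnits_le {N : AddSubmonoid G} (hH : H ⊆ N) (hU : ∀ u ∈ units M, u ∈ N) :
    genModUnits M H ≤ N :=
  sup_le (AddSubmonoid.closure_le.2 hH) hU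

theorem genModUnits_le_self (hH : H ⊆ M) : genModUnits M H ≤ M :=
  genModUnits_le hH fun _ hu => hu.1

theorem exists_sub_mem_closure_of_notMem {S : Set G} {N : AddSubmonoid G}
    (hx : x ∈ AddSubmonoid.closure S) (hxN : x ∉ N) :
    ∃ v ∈ S, v ∉ N ∧ x - v ∈ AddSubmonoid.closure S := by
  induction hx using AddSubmonoid.closure_induction with
  | mem v hv => exact ⟨v, hv, hxN, by simp⟩
  | zero => exact absurd N.zero_mem hxN
  | add a b ha hb iha ihb =>
    by_cases haN : a ∈ N
    · obtain ⟨v, hv, hvN, h⟩ := ihb fun hbN => hxN (add_mem haN hbN)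
      exact ⟨v, hv, hvN, by rw [add_sub_assoc]; exact add_mem ha h⟩
    · obtain ⟨v, hv, hvN, h⟩ := iha haN
      exact ⟨v, hv, hvN, by rw [add_sub_right_comm]; exact add_mem h hb⟩

theorem exists_sub_mem_genModUnits_of_notMem {N : AddSubmonoid G} (hU : ∀ u ∈ units M, u ∈ N)
    (hx : x ∈ genModUnits M H) (hxN : x ∉ N) :
    ∃ v ∈ H, v ∉ N ∧ x - v ∈ genModUnits M H := by
  rw [genModUnits_eq_closure] at hx ⊢
  obtain ⟨v, hv | hv, hvN, h⟩ := exists_sub_mem_closure_of_notMem hx hxN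
  · exact ⟨v, hv, hvN, h⟩
  · exact absurd (hU v hv) hvN

namespace IsHilbertBasis

variable {B : Set G} {y : G}

theorem genModUnits_eq (hB : IsHilbertBasis M B) : genModUnits M B = M := hB.1

theorem subset (hB : IsHilbertBasis M B) : B ⊆ M := fun _ hx =>
  hB.genModUnits_eq.le (mem_genModUnits_of_mem hx)

theorem notMem_genModUnits_diff (hB : IsHilbertBasis M B) (hx : x ∈ B) :
    x ∉ genModUnits M (B \ {x}) := by
  intro h
  have hsub : B ⊆ genModUnits M (B \ {x}) := fun y hy => by
    by_cases hyx : y = x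
    · rwa [hyx]
    · exact mem_genModUnits_of_mem ⟨hy, hyx⟩
  have hgen : genModUnits M (B \ {x}) = M := by
    refine le_antisymm (genModUnits_le_self (Set.sdiff_subset.trans hB.subset)) ?_
    exact hB.genModUnits_eq.ge.trans (genModUnits_le hsub fun _ => mem_genModUnits_of_unit)
  exact (hB.2 hgen Set.sdiff_subset hx).2 rfl

theorem isIrred (hB : IsHilbertBasis M B) (hx : x ∈ B) : IsIrred M x where
  not_unit h := hB.notMem_genModUnits_diff hx (mem_genModUnits_of_unit h)
  unit_or_unit a ha b hb hab := by
    have mem_diff : ∀ c ∈ M, ∀ d ∈ M, c + d = x → d ∉ units M → c ∈ genModUnits M (B \ {x}) := by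
      rintro c hc d hd rfl hdu
      by_contra hcx
      obtain ⟨v, hv, hvx, hcv⟩ := exists_sub_mem_genModUnits_of_notMem
        (fun _ => mem_genModUnits_of_unit) (hB.genModUnits_eq.ge hc) hcx
      obtain rfl : v = c + d := by
        by_contra hne
        exact hvx (mem_genModUnits_of_mem ⟨hv, hne⟩)
      exact hdu ⟨hd, by simpa using hB.genModUnits_eq.le hcv⟩
    by_contra! ⟨hau, hbu⟩
    refine hB.notMem_genModUnits_diff hx ?_
    nth_rewrite 2 [← hab]
    exact add_mem (mem_diff a ha b hb hab hbu) (mem_diff b hb a ha (by rwa [add_comm]) hau)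

theorem isAntichain (hB : IsHilbertBasis M B) : IsAntichain (Divides M) B := by
  intro x hx y hy hne hxy
  have hunit : y - x ∈ units M :=
    ((hB.isIrred hy).unit_or_unit x (hB.subset hx) _ hxy (by abel)).resolve_left
      (hB.isIrred hx).not_unit
  apply hB.notMem_genModUnits_diff hy
  have hx_diff : x ∈ B \ {y} := ⟨hx, hne⟩
  simpa using add_mem (mem_genModUnits_of_mem hx_diff) (mem_genModUnits_of_unit hunit)

theorem finite (hB : IsHilbertBasis M B) (hM : (M : Set G).PartiallyWellOrderedOn (Divides M)) :
    B.Finite :=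
  hB.isAntichain.finite_of_partiallyWellOrderedOn (hM.mono hB.subset)

end IsHilbertBasis

namespace IsAutoReduction

variable {E E' : Set G}

theorem isHilbertBasis (h : IsAutoReduction M E E') (hgen : GeneratesModUnits M E') :
    IsHilbertBasis M E' := by
  refine ⟨hgen, fun H (hH : genModUnits M H = M) hHE x hx => ?_⟩
  by_contra hxH
  have hxM : x ∈ M := le_of_eq hgen (mem_genModUnits_of_mem hx)
  obtain ⟨v, hv, hvu, hxv⟩ := exists_sub_mem_genModUnits_of_notMem
    (N := (units M).toAddSubmonoid) (fun _ hu => hu) (hH.ge hxM) (h.not_unit x hx)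
  exact h.not_reduced x hx v (hHE hv) ⟨hvu, fun hxv => hxH (hxv ▸ hv), hH.le hxv⟩

theorem exists_divides (h : IsAutoReduction M E E') (hx : x ∈ E) (hxu : x ∉ units M) :
    ∃ w ∈ E', Divides M w x := by
  by_cases hxE : x ∈ E'
  · exact ⟨x, hxE, Divides.refl M x⟩
  · obtain ⟨w, hw, -, -, hwx⟩ := (h.discarded x hx hxE).resolve_left hxu
    exact ⟨w, hw, hwx⟩

end IsAutoReduction

end Generation

section WellQuasiOrder

variable {G : Type*} [AddCommGroup G] {M : AddSubmonoid G}

theorem GeneratesModUnits.partiallyWellOrderedOn {H : Set G} (hH : GeneratesModUnits M H)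
    (hfin : H.Finite) : (M : Set G).PartiallyWellOrderedOn (Divides M) := by
  have := hfin.fintype
  have hHM : H ⊆ M := fun x hx => le_of_eq hH (mem_genModUnits_of_mem hx)
  have hdecomp : ∀ x ∈ M, ∃ c : H → ℕ, ∃ u ∈ units M, ∑ v, c v • (v : G) + u = x := by
    intro x hx
    obtain ⟨y, hy, u, hu, rfl⟩ := AddSubmonoid.mem_sup.1 (ge_of_eq hH hx)
    obtain ⟨c, rfl⟩ := AddSubmonoid.mem_closure_iff_of_fintype.1 hy
    exact ⟨c, u, hu, rfl⟩
  rw [Set.partiallyWellOrderedOn_iff_exists_lt]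
  intro f hf
  choose c u hu hc using fun k => hdecomp (f k) (hf k)
  obtain ⟨i, j, hij, hle⟩ := wellQuasiOrdered_le c
  have hsub : f j - f i = ∑ v : H, (c j v - c i v) • (v : G) + (u j - u i) := by
    simp only [← hc, sub_nsmul _ (hle _), ← sub_eq_add_neg, Finset.sum_sub_distrib]
    abel
  refine ⟨i, j, hij, ?_⟩
  rw [Divides, hsub]
  exact add_mem (sum_mem fun v _ => nsmul_mem (hHM v.2) _) (sub_mem (hu j) (hu i)).1

theorem partiallyWellOrderedOn_of_mem_iff_forall_nonneg {ι : Type*} [Finite ι] (a : ι → G →+ ℤ)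
    (hM : ∀ x, x ∈ M ↔ ∀ j, 0 ≤ a j x) : (M : Set G).PartiallyWellOrderedOn (Divides M) := by
  rw [Set.partiallyWellOrderedOn_iff_exists_lt]
  intro f hf
  obtain ⟨i, j, hij, hle⟩ := wellQuasiOrdered_le fun k t => (a t (f k)).toNat
  refine ⟨i, j, hij, (hM _).2 fun t => ?_⟩
  have hi := (hM _).1 (hf i) t
  have hj := (hM _).1 (hf j) t
  have hle : (a t (f i)).toNat ≤ (a t (f j)).toNat := hle t
  rw [map_sub]
  lia

theorem partiallyWellOrderedOn_cutPos (hM : (M : Set G).PartiallyWellOrderedOn (Divides M))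
    (lam : G →ₗ[ℤ] ℤ) :
    (cutPos M lam : Set G).PartiallyWellOrderedOn (Divides (cutPos M lam)) := by
  rw [Set.partiallyWellOrderedOn_iff_exists_lt]
  intro f hf
  obtain ⟨g, hg⟩ := hM.exists_monotone_subseq fun k => (hf k).1
  obtain ⟨i, j, hij, hle⟩ := wellQuasiOrdered_le fun k => (lam (f (g k))).toNat
  have hi := (hf (g i)).2
  have hj := (hf (g j)).2
  exact ⟨g i, g j, g.strictMono hij, hg i j hij.le, by rw [map_sub]; lia⟩

end WellQuasiOrder

section Cuts

variable {G : Type*} [AddCommGroup G] {M : AddSubmonoid G} {lam : G →ₗ[ℤ] ℤ} {x : G}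

theorem cutPos_neg (M : AddSubmonoid G) (lam : G →ₗ[ℤ] ℤ) : cutPos M (-lam) = cutNeg M lam := by
  ext x
  exact and_congr_right fun _ => by simp

theorem cutNeg_neg (M : AddSubmonoid G) (lam : G →ₗ[ℤ] ℤ) : cutNeg M (-lam) = cutPos M lam := by
  rw [← cutPos_neg, neg_neg]

theorem mem_units_cutPos : x ∈ units (cutPos M lam) ↔ x ∈ units M ∧ lam x = 0 := by
  constructor
  · rintro ⟨⟨hx, hpos⟩, hx', hneg⟩
    rw [map_neg] at hneg
    exact ⟨⟨hx, hx'⟩, by lia⟩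
  · rintro ⟨⟨hx, hx'⟩, hzero⟩
    exact ⟨⟨hx, hzero.ge⟩, hx', by rw [map_neg, hzero, neg_zero]⟩

theorem exists_pos_sub_mem_genModUnits {H : Set G} {p : G} (hp : p ∈ genModUnits (cutPos M lam) H)
    (hp0 : 0 < lam p) : ∃ x ∈ H, 0 < lam x ∧ p - x ∈ genModUnits (cutPos M lam) H := by
  obtain ⟨x, hx, hx0, hpx⟩ := exists_sub_mem_genModUnits_of_notMem (N := cutNeg ⊤ lam)
    (fun u hu => ⟨trivial, (mem_units_cutPos.1 hu).2.le⟩) hp fun h => h.2.not_gt hp0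
  exact ⟨x, hx, not_le.1 fun h => hx0 ⟨trivial, h⟩, hpx⟩

theorem units_cutPos_neg (M : AddSubmonoid G) (lam : G →ₗ[ℤ] ℤ) :
    units (cutPos M (-lam)) = units (cutPos M lam) := by
  ext x
  rw [mem_units_cutPos, mem_units_cutPos, LinearMap.neg_apply, neg_eq_zero]

theorem genModUnits_cutPos_neg (M : AddSubmonoid G) (lam : G →ₗ[ℤ] ℤ) (H : Set G) :
    genModUnits (cutPos M (-lam)) H = genModUnits (cutPos M lam) H := by
  rw [genModUnits, units_cutPos_neg, genModUnits]

theorem extend_neg (lam : G →ₗ[ℤ] ℤ) (B : Set G) : extend (-lam) B = extend lam B := by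
  unfold extend
  congr 1
  ext z
  simp only [LinearMap.neg_apply, Left.neg_pos_iff, Left.neg_neg_iff]
  constructor <;>
  · rintro ⟨x, hx, y, hy, hx0, hy0, hne, rfl⟩
    exact ⟨y, hy, x, hx, hy0, hx0, by rwa [add_comm], add_comm x y⟩

theorem finite_extend (lam : G →ₗ[ℤ] ℤ) {B : Set G} (hB : B.Finite) : (extend lam B).Finite := by
  refine hB.union ((hB.add hB).subset ?_)
  rintro z ⟨x, hx, y, hy, -, -, -, rfl⟩
  exact Set.add_mem_add hx hy

theorem extend_subset (lam : G →ₗ[ℤ] ℤ) {B : Set G} (hB : B ⊆ M) : extend lam B ⊆ M := by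
  rintro z (hz | ⟨x, hx, y, hy, -, -, -, rfl⟩)
  · exact hB hz
  · exact add_mem (hB hx) (hB hy)

theorem IsIrred.cutPos_of_lt (hx : IsIrred M x)
    (hmin : ∀ u ∈ units M, 0 < lam u → lam x < lam u) : IsIrred (cutPos M lam) x where
  not_unit h := hx.not_unit (mem_units_cutPos.1 h).1
  unit_or_unit a ha b hb hab := by
    have hsum : lam a + lam b = lam x := by rw [← map_add, hab]
    have ha0 := ha.2
    have hb0 := hb.2
    refine (hx.unit_or_unit a ha.1 b hb.1 hab).imp (fun hu => mem_units_cutPos.2 ⟨hu, ?_⟩)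
      fun hu => mem_units_cutPos.2 ⟨hu, ?_⟩ <;>
    · have := hmin _ hu
      lia

theorem isIrred_cutPos_of_unit {h : G} (hh : h ∈ units M) (hpos : 0 < lam h)
    (hmin : ∀ u ∈ units M, 0 < lam u → lam h ≤ lam u) : IsIrred (cutPos M lam) h where
  not_unit h0 := hpos.ne' (mem_units_cutPos.1 h0).2
  unit_or_unit a ha b hb hab := by
    have hsum : lam a + lam b = lam h := by rw [← map_add, hab]
    have ha0 := ha.2
    have hb0 := hb.2
    have hau : a ∈ units M := mem_units_of_add_mem_units ha.1 hb.1 (hab ▸ hh)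
    have hbu : b ∈ units M := mem_units_of_add_mem_units hb.1 ha.1 (by rwa [add_comm, hab])
    refine (eq_or_ne (lam a) 0).imp (fun h0 => mem_units_cutPos.2 ⟨hau, h0⟩)
      fun h0 => mem_units_cutPos.2 ⟨hbu, ?_⟩
    have := hmin a hau
    lia

end Cuts

section InitialSet

variable {G : Type*} [AddCommGroup G] {M : AddSubmonoid G} {lam : G →ₗ[ℤ] ℤ} {B B₀ : Set G}
  {h : G}

/-- The properties of the initial set that concern `M⁺`: its elements in `M⁺` are irreducible there,
and it contains a unit of `M` at which `lam` takes its smallest positive value on `U(M)`, if there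
is such a value. -/
structure IsHalfStart (M : AddSubmonoid G) (lam : G →ₗ[ℤ] ℤ) (B₀ : Set G) : Prop where
  irred : ∀ x ∈ B₀, 0 ≤ lam x → IsIrred (cutPos M lam) x
  exists_unit : ∀ u ∈ units M, 0 < lam u → ∃ h ∈ B₀, h ∈ units M ∧ 0 < lam h ∧ lam h ≤ lam u

/-- The properties of the initial set on which the algorithm relies. They are symmetric in `lam`
and `-lam`, whereas `IsInitialSet` is not obviously so. -/
structure IsStart (M : AddSubmonoid G) (lam : G →ₗ[ℤ] ℤ) (B₀ : Set G) : Prop where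
  finite : B₀.Finite
  subset : B₀ ⊆ M
  gen : M ≤ genModUnits (cutPos M lam) B₀
  pos : IsHalfStart M lam B₀
  neg : IsHalfStart M (-lam) B₀

theorem IsStart.symm (hB₀ : IsStart M lam B₀) : IsStart M (-lam) B₀ where
  finite := hB₀.finite
  subset := hB₀.subset
  gen := by rw [genModUnits_cutPos_neg]; exact hB₀.gen
  pos := hB₀.neg
  neg := by rw [neg_neg]; exact hB₀.pos

theorem isHalfStart_of_units_vanish (hB : ∀ x ∈ B, IsIrred M x)
    (hvan : ∀ u ∈ units M, lam u = 0) : IsHalfStart M lam B where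
  irred x hx _ := (hB x hx).cutPos_of_lt fun u hu hpos => absurd (hvan u hu) hpos.ne'
  exists_unit u hu hpos := absurd (hvan u hu) hpos.ne'

theorem IsHilbertBasis.isStart_of_units_vanish (hB : IsHilbertBasis M B) (hfin : B.Finite)
    (hvan : ∀ u ∈ units M, lam u = 0) : IsStart M lam B where
  finite := hfin
  subset := hB.subset
  gen := hB.genModUnits_eq.ge.trans <| genModUnits_le (fun _ => mem_genModUnits_of_mem)
    fun u hu => mem_genModUnits_of_unit (mem_units_cutPos.2 ⟨hu, hvan u hu⟩)
  pos := isHalfStart_of_units_vanish (fun _ => hB.isIrred) hvan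
  neg := isHalfStart_of_units_vanish (fun _ => hB.isIrred) fun u hu => by simp [hvan u hu]

theorem isHalfStart_of_unit (hh : h ∈ units M) (hpos : 0 < lam h)
    (hdvd : ∀ u ∈ units M, lam h ∣ lam u) (hmem : h ∈ B₀)
    (hB₀ : ∀ x ∈ B₀, 0 ≤ lam x → x = h ∨ IsIrred M x ∧ lam x < lam h) :
    IsHalfStart M lam B₀ := by
  have hmin : ∀ u ∈ units M, 0 < lam u → lam h ≤ lam u := fun u hu hu0 =>
    Int.le_of_dvd hu0 (hdvd u hu)
  refine ⟨fun x hx hx0 => ?_, fun u hu hu0 => ⟨h, hmem, hh, hpos, hmin u hu hu0⟩⟩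
  rcases hB₀ x hx hx0 with rfl | ⟨hirr, hlt⟩
  · exact isIrred_cutPos_of_unit hh hpos hmin
  · exact hirr.cutPos_of_lt fun u hu hu0 => hlt.trans_le (hmin u hu hu0)

theorem exists_shift_eq_add_zsmul (lam : G →ₗ[ℤ] ℤ) (h x : G) :
    ∃ k : ℤ, shift lam h x = x + k • h := by
  unfold shift
  split_ifs
  · exact ⟨-(lam x / lam h), by rw [neg_smul, sub_eq_add_neg]⟩
  · exact ⟨lam (-x) / lam h, by rw [smul_neg, sub_neg_eq_add]⟩

theorem abs_shift_lt (hpos : 0 < lam h) (x : G) : |lam (shift lam h x)| < lam h := by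
  have hmod : ∀ n : ℤ, |n % lam h| < lam h := fun n => by
    rw [abs_of_nonneg (Int.emod_nonneg n hpos.ne')]
    exact Int.emod_lt_of_pos n hpos
  unfold shift
  split_ifs
  · convert hmod (lam x) using 2
    rw [map_sub, map_smul, smul_eq_mul, Int.emod_def]
    ring
  · convert hmod (lam (-x)) using 1
    rw [← abs_neg, map_sub, map_smul, smul_eq_mul, map_neg, map_neg, Int.emod_def]
    ring_nf

theorem IsZBasis.zmultiples_sup_eq {U V : AddSubgroup G} {n : ℕ} {b : Fin n → G}
    (hb : IsZBasis V b) (hbh : IsZBasis U (Fin.cons h b : Fin (n + 1) → G)) :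
    AddSubgroup.zmultiples h ⊔ V = U := by
  rw [← hbh.2, Fin.range_cons, Set.insert_eq, AddSubgroup.closure_union, hb.2,
    AddSubgroup.zmultiples_eq_closure]

theorem dvd_of_mem_units (hU : AddSubgroup.zmultiples h ⊔ units (cutPos M lam) = units M)
    {u : G} (hu : u ∈ units M) : lam h ∣ lam u := by
  rw [← hU] at hu
  obtain ⟨_, ⟨k, rfl⟩, v, hv, rfl⟩ := AddSubgroup.mem_sup.1 hu
  exact ⟨k, by simp [(mem_units_cutPos.1 hv).2, mul_comm]⟩

theorem le_genModUnits_shift (hgen : GeneratesModUnits M B)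
    (hU : AddSubgroup.zmultiples h ⊔ units (cutPos M lam) = units M) :
    M ≤ genModUnits (cutPos M lam) (shift lam h '' B ∪ {h, -h}) := by
  set N := genModUnits (cutPos M lam) (shift lam h '' B ∪ {h, -h})
  have hh : h ∈ units N := ⟨mem_genModUnits_of_mem (by simp), mem_genModUnits_of_mem (by simp)⟩
  have hzsmul : ∀ k : ℤ, k • h ∈ N := fun k =>
    have hk : k • h ∈ units N := zsmul_mem hh k
    hk.1
  refine (ge_of_eq hgen).trans (genModUnits_le (fun x hx => ?_) fun u hu => ?_)
  · obtain ⟨k, hk⟩ := exists_shift_eq_add_zsmul lam h x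
    have hx' : x = shift lam h x + (-k) • h := by rw [hk, neg_smul, add_neg_cancel_right]
    rw [hx']
    exact add_mem (mem_genModUnits_of_mem (Or.inl ⟨x, hx, rfl⟩)) (hzsmul _)
  · rw [← hU] at hu
    obtain ⟨_, ⟨k, rfl⟩, v, hv, rfl⟩ := AddSubgroup.mem_sup.1 hu
    exact add_mem (hzsmul k) (mem_genModUnits_of_unit hv)

theorem IsHilbertBasis.isStart_shift (hB : IsHilbertBasis M B) (hfin : B.Finite)
    (hh : h ∈ units M) (hpos : 0 < lam h)
    (hU : AddSubgroup.zmultiples h ⊔ units (cutPos M lam) = units M) :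
    IsStart M lam (shift lam h '' B ∪ {h, -h}) := by
  have hshift : ∀ x ∈ B, IsIrred M (shift lam h x) ∧ shift lam h x ∈ M := fun x hx => by
    obtain ⟨k, hk⟩ := exists_shift_eq_add_zsmul lam h x
    have hkh : k • h ∈ units M := zsmul_mem hh k
    rw [hk]
    exact ⟨(hB.isIrred hx).add_unit hkh, add_mem (hB.subset hx) hkh.1⟩
  have hdvd : ∀ u ∈ units M, lam h ∣ lam u := fun _ => dvd_of_mem_units hU
  refine ⟨(hfin.image _).union (by simp), ?_, le_genModUnits_shift hB.1 hU,
    isHalfStart_of_unit hh hpos hdvd (by simp) ?_,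
    isHalfStart_of_unit (h := -h) (neg_mem hh) (by simpa using hpos)
      (by simpa using hdvd) (by simp) ?_⟩
  · rintro _ (⟨x, hx, rfl⟩ | rfl | rfl)
    · exact (hshift x hx).2
    · exact hh.1
    · exact hh.2
  · rintro _ (⟨x, hx, rfl⟩ | rfl | rfl) hx0
    · exact Or.inr ⟨(hshift x hx).1, (abs_lt.1 (abs_shift_lt hpos x)).2⟩
    · exact Or.inl rfl
    · rw [map_neg] at hx0
      lia
  · rintro _ (⟨x, hx, rfl⟩ | rfl | rfl) hx0
    · refine Or.inr ⟨(hshift x hx).1, ?_⟩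
      simpa using (neg_le_abs _).trans_lt (abs_shift_lt hpos x)
    · rw [LinearMap.neg_apply] at hx0
      lia
    · exact Or.inl rfl

theorem IsInitialSet.isStart (hB₀ : IsInitialSet M lam B B₀) (hB : IsHilbertBasis M B)
    (hfin : B.Finite) : IsStart M lam B₀ := by
  rcases hB₀ with ⟨hvan, rfl⟩ | ⟨⟨u, hu, hu0⟩, n, b, h, hb, hh, hh0, hbh, rfl⟩
  · exact hB.isStart_of_units_vanish hfin hvan
  · have hU := hb.zmultiples_sup_eq hbh
    have hne : lam h ≠ 0 := fun h0 => hu0 (by simpa [h0] using dvd_of_mem_units hU hu)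
    exact hB.isStart_shift hfin hh (hh0.lt_of_ne hne.symm) hU

end InitialSet

section Correctness

variable {G : Type*} [AddCommGroup G] {M : AddSubmonoid G} {lam : G →ₗ[ℤ] ℤ} {P Q : Set G} {z : G}

/-- `P` and `Q` are the two halves of a set on which a step of the algorithm has no effect. The
conditions are symmetric in `lam` and `-lam`. -/
structure IsStable (M : AddSubmonoid G) (lam : G →ₗ[ℤ] ℤ) (P Q : Set G) : Prop where
  pos : IsAutoReduction (cutPos M lam) {x ∈ extend lam (P ∪ Q) | 0 ≤ lam x} P
  neg : IsAutoReduction (cutNeg M lam) {x ∈ extend lam (P ∪ Q) | lam x ≤ 0} Q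
  subset : P ∪ Q ⊆ M
  gen : M ≤ genModUnits (cutPos M lam) (P ∪ Q)
  le_of_unit_pos : ∀ u ∈ units M, 0 < lam u → ∀ x ∈ P, lam x ≤ lam u
  le_of_unit_neg : ∀ u ∈ units M, lam u < 0 → ∀ x ∈ Q, lam u ≤ lam x

/-- The induction hypothesis of the correctness proof: `P` generates, modulo units, the elements of
`M⁺` that properly divide `z`. Divisibility is that of `M`, not of `M⁺`. -/
def GeneratesBelow (M : AddSubmonoid G) (lam : G →ₗ[ℤ] ℤ) (P : Set G) (z : G) : Prop :=
  ∀ w ∈ cutPos M lam, Divides M w z → ¬ Divides M z w → w ∈ genModUnits (cutPos M lam) P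

namespace IsStable

theorem symm (hS : IsStable M lam P Q) : IsStable M (-lam) Q P where
  pos := by simpa [cutPos_neg, extend_neg, Set.union_comm] using hS.neg
  neg := by simpa [cutNeg_neg, extend_neg, Set.union_comm] using hS.pos
  subset := by rw [Set.union_comm]; exact hS.subset
  gen := by rw [genModUnits_cutPos_neg, Set.union_comm]; exact hS.gen
  le_of_unit_pos u hu hl x hx := by
    simpa using hS.le_of_unit_neg u hu (by simpa using hl) x hx
  le_of_unit_neg u hu hl x hx := by
    simpa using hS.le_of_unit_pos u hu (by simpa using hl) x hx

theorem subset_cutPos (hS : IsStable M lam P Q) : P ⊆ cutPos M lam := fun _ hx =>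
  ⟨hS.subset (Or.inl hx), (hS.pos.subset hx).2⟩

theorem lt_of_mem_extend (hS : IsStable M lam P Q) {e u : G} (he : e ∈ extend lam (P ∪ Q))
    (heP : e ∉ P) (hu : u ∈ units M) (hpos : 0 < lam u) : lam e < lam u := by
  rcases he with (h | h) | ⟨x, hx, y, -, hx0, hy0, -, rfl⟩
  · exact absurd h heP
  · exact (hS.neg.subset h).2.trans_lt hpos
  · have hxP : x ∈ P := hx.resolve_right fun hxQ => (hS.neg.subset hxQ).2.not_gt hx0
    have := hS.le_of_unit_pos u hu hpos x hxP
    rw [map_add]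
    lia

theorem mem_genModUnits_of_mem_extend (hS : IsStable M lam P Q)
    (hbelow : GeneratesBelow M lam P z) {e : G} (he : e ∈ extend lam (P ∪ Q)) (he0 : 0 ≤ lam e)
    (hez : Divides M e z) : e ∈ genModUnits (cutPos M lam) P := by
  by_cases heP : e ∈ P
  · exact mem_genModUnits_of_mem heP
  rcases hS.pos.discarded e ⟨he, he0⟩ heP with heu | ⟨v, hv, hvu, -, hev⟩
  · exact mem_genModUnits_of_unit heu
  have hvM := hS.subset_cutPos hv
  have hvM_unit : v ∉ units M := fun hvM_unit => by
    have hv0 : lam v ≠ 0 := fun h0 => hvu (mem_units_cutPos.2 ⟨hvM_unit, h0⟩)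
    have hlt := hS.lt_of_mem_extend he heP hvM_unit (hvM.2.lt_of_ne hv0.symm)
    have hle := hev.2
    rw [map_sub] at hle
    lia
  have hdvd : Divides M (e - v) z := by
    rw [Divides, sub_sub_eq_add_sub, add_sub_right_comm]
    exact add_mem hez hvM.1
  have hproper : ¬ Divides M z (e - v) := fun h => by
    have hneg : -v = (z - e) + (e - v - z) := by abel
    have hnegM : -v ∈ M := by rw [hneg]; exact add_mem hez h
    exact hvM_unit ⟨hvM.1, hnegM⟩
  simpa using add_mem (hbelow _ hev hdvd hproper) (mem_genModUnits_of_mem hv)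

theorem mem_genModUnits_of_eq_zero (hS : IsStable M lam P Q) (hbelow : GeneratesBelow M lam P z)
    {m : G} (hm : m ∈ genModUnits (cutPos M (-lam)) Q) (hm0 : lam m = 0) (hmz : Divides M m z) :
    m ∈ genModUnits (cutPos M lam) P := by
  have hle := genModUnits_le_self hS.symm.subset_cutPos
  rw [genModUnits_eq_closure] at hm hle
  induction hm using AddSubmonoid.closure_induction with
  | mem w hw =>
    rcases hw with hw | hw
    · exact hS.mem_genModUnits_of_mem_extend hbelow (Or.inl (Or.inr hw)) hm0.ge hmz
    · exact mem_genModUnits_of_unit (by rwa [SetLike.mem_coe, units_cutPos_neg] at hw)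
  | zero => exact zero_mem _
  | add a b ha hb iha ihb =>
    obtain ⟨haM, ha0⟩ := hle ha
    obtain ⟨hbM, hb0⟩ := hle hb
    rw [LinearMap.neg_apply] at ha0 hb0
    rw [map_add] at hm0
    have hab : Divides M a (a + b) := by simpa [Divides] using hbM
    have hba : Divides M b (a + b) := by simpa [Divides] using haM
    exact add_mem (iha (by lia) (hab.trans hmz)) (ihb (by lia) (hba.trans hmz))

theorem exists_add_of_mem (hS : IsStable M lam P Q) (hz : z ∈ M) :
    ∃ p ∈ genModUnits (cutPos M lam) P, ∃ m ∈ genModUnits (cutPos M (-lam)) Q, p + m = z := by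
  have hle : genModUnits (cutPos M lam) (P ∪ Q) ≤
      genModUnits (cutPos M lam) P ⊔ genModUnits (cutPos M (-lam)) Q := by
    refine genModUnits_le ?_ fun u hu => AddSubmonoid.mem_sup_left (mem_genModUnits_of_unit hu)
    rintro x (hx | hx)
    · exact AddSubmonoid.mem_sup_left (mem_genModUnits_of_mem hx)
    · exact AddSubmonoid.mem_sup_right (mem_genModUnits_of_mem hx)
  exact AddSubmonoid.mem_sup.1 (hle (hS.gen hz))

theorem exists_add_eq_of_neg (hS : IsStable M lam P Q) (hpos : GeneratesBelow M lam P z)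
    (hneg : GeneratesBelow M (-lam) Q z) {p m : G} (hp : p ∈ genModUnits (cutPos M lam) P)
    (hm : m ∈ genModUnits (cutPos M (-lam)) Q) (hz : p + m = z) (hp0 : 0 < lam p)
    (hm0 : lam m < 0) : ∃ p' ∈ genModUnits (cutPos M lam) P,
      ∃ m' ∈ genModUnits (cutPos M (-lam)) Q, p' + m' = z ∧ lam p' < lam p := by
  obtain ⟨x, hx, hx0, hpx⟩ := exists_pos_sub_mem_genModUnits hp hp0
  obtain ⟨y, hy, hy0, hmy⟩ := exists_pos_sub_mem_genModUnits hm (by simpa using hm0)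
  have hy0 : lam y < 0 := by simpa using hy0
  have hsum : (p - x) + (m - y) = z - (x + y) := by rw [← hz]; abel
  have hdvd : Divides M (x + y) z := by
    rw [Divides, ← hsum]
    exact add_mem (genModUnits_le_self hS.subset_cutPos hpx).1
      (genModUnits_le_self hS.symm.subset_cutPos hmy).1
  by_cases h0 : x + y = 0
  · exact ⟨p - x, hpx, m - y, hmy, by simpa [h0] using hsum, by simpa using hx0⟩
  have hext : x + y ∈ extend lam (P ∪ Q) :=
    Or.inr ⟨x, Or.inl hx, y, Or.inr hy, hx0, hy0, h0, rfl⟩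
  rcases le_total 0 (lam (x + y)) with hxy | hxy
  · have hgen := hS.mem_genModUnits_of_mem_extend hpos hext hxy hdvd
    refine ⟨_, add_mem hpx hgen, _, hmy, by rw [add_right_comm, hsum, sub_add_cancel], ?_⟩
    simp only [map_add, map_sub]
    lia
  · have hgen := hS.symm.mem_genModUnits_of_mem_extend hneg
      (by rwa [extend_neg, Set.union_comm]) (by rw [LinearMap.neg_apply]; lia) hdvd
    refine ⟨_, hpx, _, add_mem hmy hgen, by rw [← add_assoc, hsum, sub_add_cancel], ?_⟩
    simpa using hx0

theorem exists_add_eq (hS : IsStable M lam P Q) (hpos : GeneratesBelow M lam P z)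
    (hneg : GeneratesBelow M (-lam) Q z) (hz : z ∈ cutPos M lam) :
    ∃ p ∈ genModUnits (cutPos M lam) P, ∃ m ∈ genModUnits (cutPos M (-lam)) Q,
      p + m = z ∧ lam m = 0 := by
  suffices hcancel : ∀ n : ℕ, ∀ p ∈ genModUnits (cutPos M lam) P,
      ∀ m ∈ genModUnits (cutPos M (-lam)) Q, p + m = z → (lam p).toNat = n →
        ∃ p ∈ genModUnits (cutPos M lam) P, ∃ m ∈ genModUnits (cutPos M (-lam)) Q,
          p + m = z ∧ lam m = 0 by
    obtain ⟨p, hp, m, hm, hpm⟩ := hS.exists_add_of_mem hz.1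
    exact hcancel _ p hp m hm hpm rfl
  intro n
  induction n using Nat.strong_induction_on with
  | _ n ih =>
    rintro p hp m hm hpm rfl
    by_cases hm0 : lam m = 0
    · exact ⟨p, hp, m, hm, hpm, hm0⟩
    have hm_nonpos : lam m ≤ 0 := by
      simpa using (genModUnits_le_self hS.symm.subset_cutPos hm).2
    have hsum : lam p + lam m = lam z := by rw [← map_add, hpm]
    have hz0 := hz.2
    obtain ⟨p', hp', m', hm', hpm', hlt⟩ :=
      hS.exists_add_eq_of_neg hpos hneg hp hm hpm (by lia) (by lia)
    exact ih _ (by lia) p' hp' m' hm' hpm' rfl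

theorem mem_genModUnits_of_generatesBelow (hS : IsStable M lam P Q)
    (hpos : GeneratesBelow M lam P z) (hneg : GeneratesBelow M (-lam) Q z)
    (hz : z ∈ cutPos M lam) : z ∈ genModUnits (cutPos M lam) P := by
  obtain ⟨p, hp, m, hm, rfl, hm0⟩ := hS.exists_add_eq hpos hneg hz
  have hdvd : Divides M m (p + m) := by
    simpa [Divides] using (genModUnits_le_self hS.subset_cutPos hp).1
  exact add_mem hp (hS.mem_genModUnits_of_eq_zero hpos hm hm0 hdvd)

theorem mem_genModUnits (hS : IsStable M lam P Q)
    (hM : (M : Set G).PartiallyWellOrderedOn (Divides M)) (hz : z ∈ M) :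
    (z ∈ cutPos M lam → z ∈ genModUnits (cutPos M lam) P) ∧
      (z ∈ cutPos M (-lam) → z ∈ genModUnits (cutPos M (-lam)) Q) := by
  apply hM.wellFoundedOn.induction hz
  intro z _ ih
  have hpos : GeneratesBelow M lam P z := fun w hw hwz hzw => (ih w hw.1 ⟨hwz, hzw⟩).1 hw
  have hneg : GeneratesBelow M (-lam) Q z := fun w hw hwz hzw => (ih w hw.1 ⟨hwz, hzw⟩).2 hw
  exact ⟨hS.mem_genModUnits_of_generatesBelow hpos hneg,
    hS.symm.mem_genModUnits_of_generatesBelow hneg (by rwa [neg_neg])⟩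

theorem isHilbertBasis_cutPos (hS : IsStable M lam P Q)
    (hM : (M : Set G).PartiallyWellOrderedOn (Divides M)) : IsHilbertBasis (cutPos M lam) P :=
  hS.pos.isHilbertBasis <| le_antisymm (genModUnits_le_self hS.subset_cutPos)
    fun _ hz => (hS.mem_genModUnits hM hz.1).1 hz

theorem isHilbertBasis_cutNeg (hS : IsStable M lam P Q)
    (hM : (M : Set G).PartiallyWellOrderedOn (Divides M)) : IsHilbertBasis (cutNeg M lam) Q :=
  cutPos_neg M lam ▸ hS.symm.isHilbertBasis_cutPos hM

end IsStable

end Correctness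

section Runs

variable {G : Type*} [AddCommGroup G] {M : AddSubmonoid G} {lam : G →ₗ[ℤ] ℤ} {B₀ : Set G}
  {Bp Bm : ℕ → Set G} {i j : ℕ} {x : G}

/-- A run of the algorithm from the initial set `B₀`. In contrast to `IsRun` this does not refer to
the construction of `B₀`, so that it is symmetric in `lam` and `-lam`. -/
structure IsRunFrom (M : AddSubmonoid G) (lam : G →ₗ[ℤ] ℤ) (B₀ : Set G) (Bp Bm : ℕ → Set G) :
    Prop where
  start : IsStart M lam B₀
  zero_pos : Bp 0 = {x ∈ B₀ | 0 ≤ lam x}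
  zero_neg : Bm 0 = {x ∈ B₀ | lam x ≤ 0}
  step_pos : ∀ i, IsAutoReduction (cutPos M lam)
    {x ∈ extend lam (Bp i ∪ Bm i) | 0 ≤ lam x} (Bp (i + 1))
  step_neg : ∀ i, IsAutoReduction (cutNeg M lam)
    {x ∈ extend lam (Bp i ∪ Bm i) | lam x ≤ 0} (Bm (i + 1))

theorem IsRun.exists_isRunFrom {B : Set G} (hrun : IsRun M lam B Bp Bm)
    (hB : IsHilbertBasis M B) (hfin : B.Finite) : ∃ B₀, IsRunFrom M lam B₀ Bp Bm := by
  obtain ⟨B₀, hB₀, hzero_pos, hzero_neg⟩ := hrun.init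
  exact ⟨B₀, hB₀.isStart hB hfin, hzero_pos, hzero_neg, hrun.step_pos, hrun.step_neg⟩

namespace IsRunFrom

theorem symm (hR : IsRunFrom M lam B₀ Bp Bm) : IsRunFrom M (-lam) B₀ Bm Bp where
  start := hR.start.symm
  zero_pos := by simpa using hR.zero_neg
  zero_neg := by simpa using hR.zero_pos
  step_pos i := by simpa [cutPos_neg, extend_neg, Set.union_comm] using hR.step_neg i
  step_neg i := by simpa [cutNeg_neg, extend_neg, Set.union_comm] using hR.step_pos i

theorem zero_subset (hR : IsRunFrom M lam B₀ Bp Bm) : Bp 0 ∪ Bm 0 ⊆ B₀ := by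
  rw [hR.zero_pos, hR.zero_neg]
  exact Set.union_subset (Set.sep_subset _ _) (Set.sep_subset _ _)

theorem succ_subset_extend (hR : IsRunFrom M lam B₀ Bp Bm) (i : ℕ) :
    Bp (i + 1) ∪ Bm (i + 1) ⊆ extend lam (Bp i ∪ Bm i) :=
  Set.union_subset ((hR.step_pos i).subset.trans (Set.sep_subset _ _))
    ((hR.step_neg i).subset.trans (Set.sep_subset _ _))

theorem subset (hR : IsRunFrom M lam B₀ Bp Bm) (i : ℕ) : Bp i ∪ Bm i ⊆ M := by
  induction i with
  | zero => exact hR.zero_subset.trans hR.start.subset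
  | succ i ih => exact (hR.succ_subset_extend i).trans (extend_subset lam ih)

theorem finite (hR : IsRunFrom M lam B₀ Bp Bm) (i : ℕ) : (Bp i ∪ Bm i).Finite := by
  induction i with
  | zero => exact hR.start.finite.subset hR.zero_subset
  | succ i ih => exact (finite_extend lam ih).subset (hR.succ_subset_extend i)

theorem subset_cutPos (hR : IsRunFrom M lam B₀ Bp Bm) (i : ℕ) : Bp i ⊆ cutPos M lam := by
  refine fun x hx => ⟨hR.subset i (Or.inl hx), ?_⟩
  cases i with
  | zero => exact (hR.zero_pos.le hx).2
  | succ i => exact ((hR.step_pos i).subset hx).2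

theorem not_unit (hR : IsRunFrom M lam B₀ Bp Bm) (hx : x ∈ Bp i) :
    x ∉ units (cutPos M lam) := by
  cases i with
  | zero =>
    obtain ⟨hx, hx0⟩ := hR.zero_pos.le hx
    exact (hR.start.pos.irred x hx hx0).not_unit
  | succ i => exact (hR.step_pos i).not_unit x hx

theorem exists_divides (hR : IsRunFrom M lam B₀ Bp Bm) (hij : i ≤ j) (hx : x ∈ Bp i) :
    ∃ w ∈ Bp j, Divides (cutPos M lam) w x := by
  induction j, hij using Nat.le_induction with
  | base => exact ⟨x, hx, Divides.refl _ x⟩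
  | succ j _ ih =>
    obtain ⟨w, hw, hwx⟩ := ih
    obtain ⟨v, hv, hvw⟩ := (hR.step_pos j).exists_divides
      ⟨Or.inl (Or.inl hw), (hR.subset_cutPos j hw).2⟩ (hR.not_unit hw)
    exact ⟨v, hv, hvw.trans hwx⟩

theorem exists_sub_mem_units (hR : IsRunFrom M lam B₀ Bp Bm) (hx : x ∈ B₀) (hx0 : 0 ≤ lam x)
    (i : ℕ) : ∃ w ∈ Bp i, x - w ∈ units (cutPos M lam) := by
  obtain ⟨w, hw, hwx⟩ := hR.exists_divides i.zero_le (hR.zero_pos.ge ⟨hx, hx0⟩)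
  exact ⟨w, hw, ((hR.start.pos.irred x hx hx0).unit_or_unit w (hR.subset_cutPos i hw) _ hwx
    (by abel)).resolve_left (hR.not_unit hw)⟩

theorem gen (hR : IsRunFrom M lam B₀ Bp Bm) (i : ℕ) :
    M ≤ genModUnits (cutPos M lam) (Bp i ∪ Bm i) := by
  have mem_gen : ∀ x w, w ∈ Bp i ∪ Bm i → x - w ∈ units (cutPos M lam) →
      x ∈ genModUnits (cutPos M lam) (Bp i ∪ Bm i) := fun x w hw hxw => by
    simpa using add_mem (mem_genModUnits_of_unit hxw) (mem_genModUnits_of_mem hw)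
  refine hR.start.gen.trans (genModUnits_le (fun x hx => ?_) fun _ => mem_genModUnits_of_unit)
  rcases le_total 0 (lam x) with hx0 | hx0
  · obtain ⟨w, hw, hxw⟩ := hR.exists_sub_mem_units hx hx0 i
    exact mem_gen x w (Or.inl hw) hxw
  · obtain ⟨w, hw, hxw⟩ := hR.symm.exists_sub_mem_units hx (by simpa using hx0) i
    exact mem_gen x w (Or.inr hw) (by rwa [units_cutPos_neg] at hxw)

theorem le_of_unit (hR : IsRunFrom M lam B₀ Bp Bm) {u : G} (hu : u ∈ units M)
    (hpos : 0 < lam u) (hx : x ∈ Bp (i + 1)) : lam x ≤ lam u := by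
  obtain ⟨h, hhB, hh, hh0, hhu⟩ := hR.start.pos.exists_unit u hu hpos
  obtain ⟨w, hw, hhw⟩ := hR.exists_sub_mem_units hhB hh0.le (i + 1)
  obtain ⟨hhw, hval⟩ := mem_units_cutPos.1 hhw
  have hwu : w ∈ units M := by simpa using sub_mem hh hhw
  rw [map_sub] at hval
  by_contra! hlt
  refine (hR.step_pos i).not_reduced x hx w hw ⟨hR.not_unit hw, ?_, ?_, ?_⟩
  · rintro rfl
    lia
  · rw [sub_eq_add_neg]
    exact add_mem (hR.subset_cutPos _ hx).1 hwu.2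
  · rw [map_sub]
    lia

theorem isStable (hR : IsRunFrom M lam B₀ Bp Bm)
    (heq : Bp (i + 1) ∪ Bm (i + 1) = Bp i ∪ Bm i) :
    IsStable M lam (Bp (i + 1)) (Bm (i + 1)) where
  pos := by rw [heq]; exact hR.step_pos i
  neg := by rw [heq]; exact hR.step_neg i
  subset := hR.subset _
  gen := hR.gen _
  le_of_unit_pos _ hu hpos _ hx := hR.le_of_unit hu hpos hx
  le_of_unit_neg u hu hneg x hx := by
    simpa using hR.symm.le_of_unit hu (by simpa using hneg) hx

theorem eventually_subset (hR : IsRunFrom M lam B₀ Bp Bm)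
    (hM : (M : Set G).PartiallyWellOrderedOn (Divides M))
    (hT : ∀ i, ∀ z ∈ Bp (i + 1), z ∉ Bp i ∪ Bm i → ∀ x ∈ Bp i, ¬ Reduces (cutPos M lam) x z) :
    ∀ᶠ i in Filter.atTop, Bp (i + 1) ⊆ Bp i ∪ Bm i := by
  by_contra hnot
  obtain ⟨s, hs, hnew⟩ := Filter.extraction_of_frequently_atTop (Filter.not_eventually.1 hnot)
  choose z hz hznew using fun k => Set.not_subset.1 (hnew k)
  obtain ⟨k, l, hkl, hdvd⟩ := (partiallyWellOrderedOn_cutPos hM lam).exists_lt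
    fun k => hR.subset_cutPos _ (hz k)
  obtain ⟨w, hw, hwz⟩ := hR.exists_divides (Nat.succ_le_of_lt (hs hkl)) (hz k)
  have hne : z l ≠ w := fun h => hznew l (Or.inl (h ▸ hw))
  exact hT _ _ (hz l) (hznew l) w hw ⟨hR.not_unit hw, hne, hwz.trans hdvd⟩

theorem exists_union_eq (hR : IsRunFrom M lam B₀ Bp Bm)
    (hM : (M : Set G).PartiallyWellOrderedOn (Divides M))
    (hT : TestsNewAgainstOld M lam Bp Bm) :
    ∃ i, Bp (i + 1) ∪ Bm (i + 1) = Bp i ∪ Bm i := by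
  have hpos := hR.eventually_subset hM fun i => (hT i).1
  have hneg := hR.symm.eventually_subset hM fun i => by
    rw [cutPos_neg, Set.union_comm]
    exact (hT i).2
  obtain ⟨N, hN⟩ := Filter.eventually_atTop.1 (hpos.and hneg)
  have hanti : ∀ k, Bp (N + k + 1) ∪ Bm (N + k + 1) ⊆ Bp (N + k) ∪ Bm (N + k) := fun k =>
    Set.union_subset (hN _ (Nat.le_add_right N k)).1
      ((hN _ (Nat.le_add_right N k)).2.trans (Set.union_comm _ _).le)
  by_contra! hne
  exact not_strictAnti_of_wellFoundedLT (fun k => (Bp (N + k) ∪ Bm (N + k)).ncard)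
    (strictAnti_nat_of_succ_lt fun k =>
      Set.ncard_lt_ncard ((hanti k).ssubset_of_ne (hne _)) (hR.finite _))

end IsRunFrom

end Runs

section RationalCones

theorem exists_nat_mul_eq_intCast {ι : Type*} [Finite ι] (a : ι → ℚ) :
    ∃ N : ℕ, 0 < N ∧ ∃ c : ι → ℤ, ∀ i, (c i : ℚ) = N * a i := by
  cases nonempty_fintype ι
  refine ⟨∏ i, (a i).den, Finset.prod_pos fun i _ => (a i).pos, ?_⟩
  choose k hk using fun i => Finset.dvd_prod_of_mem (fun i => (a i).den) (Finset.mem_univ i)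
  refine ⟨fun i => k i * (a i).num, fun i => ?_⟩
  rw [hk i]
  push_cast
  rw [← Rat.mul_den_eq_num (a i)]
  ring

theorem exists_int_form_nonneg_iff {ι : Type*} [Fintype ι] (a : ι → ℚ) :
    ∃ f : (ι → ℤ) →+ ℤ, ∀ x : ι → ℤ, 0 ≤ f x ↔ 0 ≤ ∑ i, (a i : ℝ) * (x i : ℝ) := by
  obtain ⟨N, hN, c, hc⟩ := exists_nat_mul_eq_intCast a
  have hcR : ∀ i, (c i : ℝ) = N * a i := fun i => by
    exact_mod_cast congrArg (Rat.cast (K := ℝ)) (hc i)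
  refine ⟨AddMonoidHom.mk' (c ⬝ᵥ ·) (dotProduct_add c), fun x => ?_⟩
  have hval : ((c ⬝ᵥ x : ℤ) : ℝ) = N * ∑ i, (a i : ℝ) * (x i : ℝ) := by
    simp only [dotProduct, Int.cast_sum, Int.cast_mul, hcR, mul_assoc, Finset.mul_sum]
  rw [AddMonoidHom.mk'_apply, ← Int.cast_nonneg_iff (R := ℝ), hval,
    mul_nonneg_iff_of_pos_left (by exact_mod_cast hN)]

theorem IsRationalCone.partiallyWellOrderedOn {d : ℕ} {C : PointedCone ℝ (Fin d → ℝ)}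
    (hC : IsRationalCone C) :
    (latticePoints C : Set (Fin d → ℤ)).PartiallyWellOrderedOn (Divides (latticePoints C)) := by
  obtain ⟨S, hS⟩ := hC
  choose f hf using exists_int_form_nonneg_iff (ι := Fin d)
  refine partiallyWellOrderedOn_of_mem_iff_forall_nonneg (fun a : S => f a) fun x => ?_
  simp only [hf, Subtype.forall]
  exact hS _

end RationalCones

end HalfspaceCut

open HalfspaceCut in
theorem mainTheorem1_general {G : Type*} [AddCommGroup G] {M : AddSubmonoid G}
    {lam : G →ₗ[ℤ] ℤ} {B : Set G} (hB : IsHilbertBasis M B) (hfin : B.Finite)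
    {Bp Bm : ℕ → Set G} (hrun : IsRun M lam B Bp Bm) :
    (TestsNewAgainstOld M lam Bp Bm →
      ∃ i, 1 ≤ i ∧ Bp i ∪ Bm i = Bp (i - 1) ∪ Bm (i - 1)) ∧
    (∀ i, 1 ≤ i → Bp i ∪ Bm i = Bp (i - 1) ∪ Bm (i - 1) →
      IsHilbertBasis (cutPos M lam) (Bp i) ∧ IsHilbertBasis (cutNeg M lam) (Bm i)) := by
  have hM := GeneratesModUnits.partiallyWellOrderedOn hB.1 hfin
  obtain ⟨B₀, hR⟩ := hrun.exists_isRunFrom hB hfin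
  refine ⟨fun hT => ?_, fun i hi heq => ?_⟩
  · obtain ⟨i, hi⟩ := hR.exists_union_eq hM hT
    exact ⟨i + 1, i.succ_pos, hi⟩
  · obtain ⟨i, rfl⟩ := Nat.exists_eq_add_of_le' hi
    have hS := hR.isStable heq
    exact ⟨hS.isHilbertBasis_cutPos hM, hS.isHilbertBasis_cutNeg hM⟩

theorem mainTheorem1 {d : ℕ} (C : PointedCone ℝ (Fin d → ℝ))
    (hC : HalfspaceCut.IsRationalCone C) (lam : (Fin d → ℤ) →ₗ[ℤ] ℤ) (B : Set (Fin d → ℤ))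
    (hB : HalfspaceCut.IsHilbertBasis (HalfspaceCut.latticePoints C) B)
    (Bp Bm : ℕ → Set (Fin d → ℤ))
    (hrun : HalfspaceCut.IsRun (HalfspaceCut.latticePoints C) lam B Bp Bm) :
    (HalfspaceCut.TestsNewAgainstOld (HalfspaceCut.latticePoints C) lam Bp Bm →
      ∃ i, 1 ≤ i ∧ Bp i ∪ Bm i = Bp (i - 1) ∪ Bm (i - 1)) ∧
    (∀ i, 1 ≤ i → Bp i ∪ Bm i = Bp (i - 1) ∪ Bm (i - 1) →
      HalfspaceCut.IsHilbertBasis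
        (HalfspaceCut.cutPos (HalfspaceCut.latticePoints C) lam) (Bp i) ∧
      HalfspaceCut.IsHilbertBasis
        (HalfspaceCut.cutNeg (HalfspaceCut.latticePoints C) lam) (Bm i)) := by
  exact mainTheorem1_general hB (hB.finite hC.partiallyWellOrderedOn) hrun
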